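/- Let $T\ge 1$ be an integer and let $\rho\in(0,1)$, $\alpha\in[0,1]$, $b>0$, $A(0)\ge 0$ and $A_0\in\mathbb{R}$. For $\delta\in\mathbb{R}$ put $\kappa=\frac{\alpha(\delta+1)^2}{b}$ and define $Q_t,M_t$ for $0\le t\le T$ by the backward recursion $$Q_T=1,\qquad M_T=0,\qquad Q_t=1+\frac{\rho Q_{t+1}}{1+\rho Q_{t+1}\kappa},\qquad M_t=\frac{\rho\,(M_{t+1}+2Q_{t+1})}{1+\rho Q_{t+1}\kappa}\qquad(0\le t<T).$$ Define the closed-form ages with estimator $\delta$ by $A^{\delta}(0)=A(0)$ and, for $1\le t\le T-1$, $$A^{\delta}(t)=\Big(\prod_{i=1}^{t}\frac{1}{1+\rho Q_i\kappa}\Big)A(0)+\frac{2-\rho M_t\kappa}{2+2\rho Q_t\kappa}+\sum_{s=1}^{t-1}\frac{2-\rho M_s\kappa}{2+2\rho Q_s\kappa}\prod_{i=s+1}^{t}\frac{1}{1+\rho Q_i\kappa}.$$ Let $\Omega=[0,A(0)+1]\times[0,A(0)+2]\times\cdots\times[0,A(0)+(T-1)]\subset\mathbb{R}^{T-1}$.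 For $x=(A(1),\dots,A(T-1))\in\mathbb{R}^{T-1}$ let $$\delta(x)=\frac{1-\rho}{1-\rho^{T}}\sum_{t=0}^{T-1}\rho^{t}\,(A(t)-A_0),\qquad \Phi(x)=\big(A^{\delta(x)}(1),\dots,A^{\delta(x)}(T-1)\big).$$ Then $\Phi$ is continuous on $\Omega$ and maps $\Omega$ into $\Omega$. Moreover $\Phi$ has a fixed point $x\in\Omega$ such that $\delta=\delta(x)$ is self-consistent, that is, $$\delta=\frac{1-\rho}{1-\rho^{T}}\sum_{t=0}^{T-1}\rho^{t}\,\big(A^{\delta}(t)-A_0\big).$$ -/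

import Mathlib

/-! Parameters used throughout:
`T` is the time horizon, `ρ` the discount factor, `α` the user-arrival probability per slot,
`b` the upper end of the support of the (uniform) sampling cost, `A₀` the transmission delay,
`a₀` the initial age `A(0)`, and `δ` the estimator of the dynamic age reduction. -/

namespace AoI

noncomputable section

/-- The recurring coefficient `α (δ + 1)² / b`. -/
def gain (α b δ : ℝ) : ℝ := α * (δ + 1) ^ 2 / b

/-- `QM ρ α b δ k = (Q_{T-k}, M_{T-k})`: the pair computed by `k` steps of the backward recursion
from the terminal values `Q_T = 1`, `M_T = 0`. -/
def QM (ρ α b δ : ℝ) : ℕ → ℝ × ℝ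
  | 0 => (1, 0)
  | k + 1 =>
    let Q' := (QM ρ α b δ k).1
    let M' := (QM ρ α b δ k).2
    (1 + ρ * Q' / (1 + ρ * Q' * gain α b δ),
      ρ * (M' + 2 * Q') / (1 + ρ * Q' * gain α b δ))

/-- The coefficient `Q_t`, for `t ≤ T`. -/
def Q (T : ℕ) (ρ α b δ : ℝ) (t : ℕ) : ℝ := (QM ρ α b δ (T - t)).1

/-- The coefficient `M_t`, for `t ≤ T`. -/
def M (T : ℕ) (ρ α b δ : ℝ) (t : ℕ) : ℝ := (QM ρ α b δ (T - t)).2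

theorem Q_terminal (T : ℕ) (ρ α b δ : ℝ) : Q T ρ α b δ T = 1 := by
  simp [Q, QM]

theorem M_terminal (T : ℕ) (ρ α b δ : ℝ) : M T ρ α b δ T = 0 := by
  simp [M, QM]

theorem Q_recursion (T : ℕ) (ρ α b δ : ℝ) (t : ℕ) (ht : t < T) :
    Q T ρ α b δ t
      = 1 + ρ * Q T ρ α b δ (t + 1) / (1 + ρ * Q T ρ α b δ (t + 1) * gain α b δ) := by
  have h : T - t = (T - (t + 1)) + 1 := by omega
  simp only [Q, h, QM]

theorem M_recursion (T : ℕ) (ρ α b δ : ℝ) (t : ℕ) (ht : t < T) :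
    M T ρ α b δ t
      = ρ * (M T ρ α b δ (t + 1) + 2 * Q T ρ α b δ (t + 1))
          / (1 + ρ * Q T ρ α b δ (t + 1) * gain α b δ) := by
  have h : T - t = (T - (t + 1)) + 1 := by omega
  simp only [M, Q, h, QM]

/-- The contraction factor `1 / (1 + ρ Q_i α (δ + 1)² / b)`. -/
def factor (T : ℕ) (ρ α b δ : ℝ) (i : ℕ) : ℝ :=
  1 / (1 + ρ * Q T ρ α b δ i * gain α b δ)

/-- The increment `(2 - ρ M_s α (δ + 1)² / b) / (2 + 2 ρ Q_s α (δ + 1)² / b)`. -/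
def increment (T : ℕ) (ρ α b δ : ℝ) (s : ℕ) : ℝ :=
  (2 - ρ * M T ρ α b δ s * gain α b δ) / (2 + 2 * ρ * Q T ρ α b δ s * gain α b δ)

/-- The closed-form expected age `A(t)` under the approximate dynamic pricing with estimator `δ`:
the initial age at `t = 0`, and the explicit formula for `t ≥ 1`. -/
def closedFormAge (T : ℕ) (ρ α b a₀ δ : ℝ) (t : ℕ) : ℝ :=
  if t = 0 then a₀
  else
    (∏ i ∈ Finset.Icc 1 t, factor T ρ α b δ i) * a₀
      + increment T ρ α b δ t
      + ∑ s ∈ Finset.Icc 1 (t - 1),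
          increment T ρ α b δ s * ∏ i ∈ Finset.Icc (s + 1) t, factor T ρ α b δ i

/-- The discounted time average `(1 - ρ) / (1 - ρ ^ T) * ∑_{t = 0}^{T - 1} ρ ^ t (A(t) - A₀)`. -/
def discountedAverage (T : ℕ) (ρ A₀ : ℝ) (A : ℕ → ℝ) : ℝ :=
  (1 - ρ) / (1 - ρ ^ T) * ∑ t ∈ Finset.range T, ρ ^ t * (A t - A₀)

/-- The age sequence `A(0), A(1), …, A(T - 1)` with initial age `a₀` and remaining entries given
by a vector `x`, where `x i` stands for `A(i + 1)`. Times `t ≥ T` are never used. -/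
def ageSequence (T : ℕ) (a₀ : ℝ) (x : Fin (T - 1) → ℝ) : ℕ → ℝ
  | 0 => a₀
  | i + 1 => if h : i < T - 1 then x ⟨i, h⟩ else 0

/-- The estimator `δ` as a function of the ages `(A(1), …, A(T - 1))`. -/
def estimator (T : ℕ) (ρ A₀ a₀ : ℝ) (x : Fin (T - 1) → ℝ) : ℝ :=
  discountedAverage T ρ A₀ (ageSequence T a₀ x)

/-- The map `Φ = (Φ_1, …, Φ_{T-1})`: insert the estimator computed from the ages into the closed
form. The coordinate with index `i` is `Φ_{i+1}`. -/
def Phi (T : ℕ) (ρ α b A₀ a₀ : ℝ) (x : Fin (T - 1) → ℝ) : Fin (T - 1) → ℝ :=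
  fun i => closedFormAge T ρ α b a₀ (estimator T ρ A₀ a₀ x) ((i : ℕ) + 1)

/-- The box `Ω = [0, A(0) + 1] × ⋯ × [0, A(0) + (T - 1)]`. -/
def Omega (T : ℕ) (a₀ : ℝ) : Set (Fin (T - 1) → ℝ) :=
  Set.univ.pi fun i => Set.Icc 0 (a₀ + (((i : ℕ) + 1 : ℕ) : ℝ))

/-- `δ` is self-consistent: it equals the discounted time average of the age reductions
`A(t) - A₀` along the closed-form ages that `δ` itself generates. -/
def SelfConsistent (T : ℕ) (ρ α b A₀ a₀ δ : ℝ) : Prop :=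
  δ = discountedAverage T ρ A₀ (closedFormAge T ρ α b a₀ δ)

end

end AoI

namespace AoI

/-! `Phi` sees its argument only through the scalar `estimator`, so no Brouwer theorem is needed:
the problem reduces to a fixed point of the real function sending `δ` to the discounted average of
the ages it generates. The ages obey an affine recursion (`closedFormAge_succ`) whose slope and
increment lie in `[0, 1]`, so `A(t) ∈ [0, a₀ + t]` for every real `δ`. Hence the scalar map is
continuous with range in a fixed compact interval, and the one-dimensional fixed point theorem
applies (`exists_selfConsistent`). The ages generated by that `δ` form the fixed point of `Phi`. -/

theorem gain_nonneg {α b : ℝ} (δ : ℝ) (hα : 0 ≤ α) (hb : 0 < b) : 0 ≤ gain α b δ := by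
  unfold gain
  positivity

theorem continuous_gain (α b : ℝ) : Continuous (gain α b) := by
  unfold gain
  fun_prop

section Bounds

variable {ρ α b : ℝ} (δ : ℝ)

theorem one_le_QM_fst (hρ : 0 ≤ ρ) (hα : 0 ≤ α) (hb : 0 < b) (k : ℕ) :
    1 ≤ (QM ρ α b δ k).1 := by
  have hg := gain_nonneg δ hα hb
  induction k with
  | zero => simp [QM]
  | succ k ih =>
    have hQ : 0 ≤ (QM ρ α b δ k).1 := by linarith
    simp only [QM, le_add_iff_nonneg_right]
    positivity

theorem QM_snd_nonneg (hρ : 0 ≤ ρ) (hα : 0 ≤ α) (hb : 0 < b) (k : ℕ) :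
    0 ≤ (QM ρ α b δ k).2 := by
  have hg := gain_nonneg δ hα hb
  induction k with
  | zero => simp [QM]
  | succ k ih =>
    have hQ : 0 ≤ (QM ρ α b δ k).1 := by linarith [one_le_QM_fst δ hρ hα hb k]
    simp only [QM]
    positivity

theorem one_le_one_add_mul_gain (hρ : 0 ≤ ρ) (hα : 0 ≤ α) (hb : 0 < b) (k : ℕ) :
    1 ≤ 1 + ρ * (QM ρ α b δ k).1 * gain α b δ := by
  have hg := gain_nonneg δ hα hb
  have hQ : 0 ≤ (QM ρ α b δ k).1 := by linarith [one_le_QM_fst δ hρ hα hb k]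
  have : 0 ≤ ρ * (QM ρ α b δ k).1 * gain α b δ := by positivity
  linarith

/-- This keeps the increments nonnegative. With `g` the gain, if `M' g ≤ 2` then `ρ (M' g + 2 Q' g)
≤ 2 (1 + ρ Q' g)`, so the bound survives each backward step. -/
theorem QM_snd_mul_gain_le_two (hρ : ρ ∈ Set.Icc (0 : ℝ) 1) (hα : 0 ≤ α) (hb : 0 < b) (k : ℕ) :
    (QM ρ α b δ k).2 * gain α b δ ≤ 2 := by
  have hg := gain_nonneg δ hα hb
  induction k with
  | zero => simp [QM]
  | succ k ih =>
    have hd := one_le_one_add_mul_gain δ hρ.1 hα hb k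
    have hM := mul_nonneg (QM_snd_nonneg δ hρ.1 hα hb k) hg
    simp only [QM]
    rw [div_mul_eq_mul_div, div_le_iff₀ (by linarith)]
    have := mul_le_mul hρ.2 ih hM zero_le_one
    linarith

theorem factor_mem_Icc (T : ℕ) (hρ : 0 ≤ ρ) (hα : 0 ≤ α) (hb : 0 < b) (t : ℕ) :
    factor T ρ α b δ t ∈ Set.Icc (0 : ℝ) 1 := by
  have hd := one_le_one_add_mul_gain δ hρ hα hb (T - t)
  unfold factor Q
  exact ⟨by positivity, div_le_one_of_le₀ hd (by linarith)⟩

theorem increment_mem_Icc (T : ℕ) (hρ : ρ ∈ Set.Icc (0 : ℝ) 1) (hα : 0 ≤ α) (hb : 0 < b)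
    (t : ℕ) : increment T ρ α b δ t ∈ Set.Icc (0 : ℝ) 1 := by
  have hd := one_le_one_add_mul_gain δ hρ.1 hα hb (T - t)
  have hM := mul_nonneg (QM_snd_nonneg δ hρ.1 hα hb (T - t)) (gain_nonneg δ hα hb)
  have hM2 := QM_snd_mul_gain_le_two δ hρ hα hb (T - t)
  have h1 := mul_le_mul hρ.2 hM2 hM zero_le_one
  have h2 := mul_nonneg hρ.1 hM
  unfold increment Q M
  exact ⟨div_nonneg (by linarith) (by linarith),
    div_le_one_of_le₀ (by linarith) (by linarith)⟩

end Bounds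

theorem closedFormAge_zero (T : ℕ) (ρ α b a₀ δ : ℝ) : closedFormAge T ρ α b a₀ δ 0 = a₀ := by
  simp [closedFormAge]

/-- Every product in the closed form ends at the current time, so its last factor can be pulled out.
Bounds and continuity then follow by induction on time. -/
theorem closedFormAge_succ (T : ℕ) (ρ α b a₀ δ : ℝ) (t : ℕ) :
    closedFormAge T ρ α b a₀ δ (t + 1)
      = factor T ρ α b δ (t + 1) * closedFormAge T ρ α b a₀ δ t
        + increment T ρ α b δ (t + 1) := by
  rcases t with _ | t
  · simp [closedFormAge]
  · have hsum : ∑ s ∈ Finset.Icc 1 t, increment T ρ α b δ s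
          * ∏ i ∈ Finset.Icc (s + 1) (t + 1 + 1), factor T ρ α b δ i
        = (∑ s ∈ Finset.Icc 1 t, increment T ρ α b δ s
          * ∏ i ∈ Finset.Icc (s + 1) (t + 1), factor T ρ α b δ i)
            * factor T ρ α b δ (t + 1 + 1) := by
      rw [Finset.sum_mul]
      refine Finset.sum_congr rfl fun s hs => ?_
      rw [Finset.mem_Icc] at hs
      rw [Finset.prod_Icc_succ_top (by omega), mul_assoc]
    simp only [closedFormAge, Nat.add_eq_zero_iff, one_ne_zero, and_false, if_false,
      Nat.add_sub_cancel]
    rw [Finset.sum_Icc_succ_top (by omega), hsum,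
      Finset.prod_Icc_succ_top (b := t + 1) (by omega)]
    simp only [Finset.Icc_self, Finset.prod_singleton]
    ring

theorem closedFormAge_mem_Icc (T : ℕ) {ρ α b a₀ : ℝ} (δ : ℝ) (hρ : ρ ∈ Set.Icc (0 : ℝ) 1)
    (hα : 0 ≤ α) (hb : 0 < b) (ha₀ : 0 ≤ a₀) (t : ℕ) :
    closedFormAge T ρ α b a₀ δ t ∈ Set.Icc 0 (a₀ + t) := by
  induction t with
  | zero => simp [closedFormAge_zero, ha₀]
  | succ t ih =>
    have hf := factor_mem_Icc δ T hρ.1 hα hb (t + 1)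
    have hi := increment_mem_Icc δ T hρ hα hb (t + 1)
    rw [closedFormAge_succ]
    have h1 := mul_le_mul hf.2 ih.2 ih.1 zero_le_one
    have h2 := mul_nonneg hf.1 ih.1
    push_cast
    exact ⟨by linarith [hi.1], by linarith [hi.2]⟩

section Continuity

variable {ρ α b : ℝ}

theorem continuous_QM (hρ : 0 ≤ ρ) (hα : 0 ≤ α) (hb : 0 < b) (k : ℕ) :
    Continuous fun δ => QM ρ α b δ k := by
  have hg := continuous_gain α b
  induction k with
  | zero => exact continuous_const
  | succ k ih =>
    have hd : ∀ δ, 1 + ρ * (QM ρ α b δ k).1 * gain α b δ ≠ 0 := fun δ => by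
      linarith [one_le_one_add_mul_gain δ hρ hα hb k]
    simp only [QM]
    fun_prop (disch := exact hd)

theorem continuous_factor (T : ℕ) (hρ : 0 ≤ ρ) (hα : 0 ≤ α) (hb : 0 < b) (t : ℕ) :
    Continuous fun δ => factor T ρ α b δ t := by
  have hg := continuous_gain α b
  have hQM := continuous_QM hρ hα hb (T - t)
  have hd : ∀ δ, 1 + ρ * (QM ρ α b δ (T - t)).1 * gain α b δ ≠ 0 := fun δ => by
    linarith [one_le_one_add_mul_gain δ hρ hα hb (T - t)]
  simp only [factor, Q]
  fun_prop (disch := exact hd)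

theorem continuous_increment (T : ℕ) (hρ : 0 ≤ ρ) (hα : 0 ≤ α) (hb : 0 < b) (t : ℕ) :
    Continuous fun δ => increment T ρ α b δ t := by
  have hg := continuous_gain α b
  have hQM := continuous_QM hρ hα hb (T - t)
  have hd : ∀ δ, 2 + 2 * ρ * (QM ρ α b δ (T - t)).1 * gain α b δ ≠ 0 := fun δ => by
    linarith [one_le_one_add_mul_gain δ hρ hα hb (T - t)]
  simp only [increment, Q, M]
  fun_prop (disch := exact hd)

theorem continuous_closedFormAge (T : ℕ) (a₀ : ℝ) (hρ : 0 ≤ ρ) (hα : 0 ≤ α) (hb : 0 < b)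
    (t : ℕ) : Continuous fun δ => closedFormAge T ρ α b a₀ δ t := by
  induction t with
  | zero => simpa only [closedFormAge_zero] using continuous_const
  | succ t ih =>
    simp only [closedFormAge_succ]
    exact ((continuous_factor T hρ hα hb _).mul ih).add (continuous_increment T hρ hα hb _)

end Continuity

theorem discountedAverage_mono (T : ℕ) {ρ : ℝ} (A₀ : ℝ) (hρ : ρ ∈ Set.Icc (0 : ℝ) 1)
    {A B : ℕ → ℝ} (h : ∀ t, A t ≤ B t) :
    discountedAverage T ρ A₀ A ≤ discountedAverage T ρ A₀ B := by
  refine mul_le_mul_of_nonneg_left (Finset.sum_le_sum fun t _ => ?_)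
    (div_nonneg (sub_nonneg.2 hρ.2) (sub_nonneg.2 (pow_le_one₀ hρ.1 hρ.2)))
  exact mul_le_mul_of_nonneg_left (sub_le_sub_right (h t) _) (pow_nonneg hρ.1 t)

theorem discountedAverage_congr (T : ℕ) (ρ A₀ : ℝ) {A B : ℕ → ℝ} (h : ∀ t < T, A t = B t) :
    discountedAverage T ρ A₀ A = discountedAverage T ρ A₀ B := by
  unfold discountedAverage
  congr 1
  exact Finset.sum_congr rfl fun t ht => by rw [h t (Finset.mem_range.1 ht)]

theorem continuous_estimator (T : ℕ) (ρ A₀ a₀ : ℝ) : Continuous (estimator T ρ A₀ a₀) := by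
  have h : ∀ t, Continuous fun x : Fin (T - 1) → ℝ => ageSequence T a₀ x t := by
    intro t
    rcases t with _ | t
    · exact continuous_const
    · by_cases ht : t < T - 1
      · simpa only [ageSequence, ht, dite_true] using continuous_apply _
      · simpa only [ageSequence, ht, dite_false] using continuous_const
  unfold estimator discountedAverage
  fun_prop

theorem exists_selfConsistent (T : ℕ) {ρ α b a₀ : ℝ} (A₀ : ℝ) (hρ : ρ ∈ Set.Icc (0 : ℝ) 1)
    (hα : 0 ≤ α) (hb : 0 < b) (ha₀ : 0 ≤ a₀) : ∃ δ, SelfConsistent T ρ α b A₀ a₀ δ := by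
  have hage := fun δ => closedFormAge_mem_Icc T δ hρ hα hb ha₀
  have hcont : Continuous fun δ => discountedAverage T ρ A₀ (closedFormAge T ρ α b a₀ δ) := by
    have := fun t => continuous_closedFormAge T a₀ hρ.1 hα hb t
    unfold discountedAverage
    fun_prop
  obtain ⟨δ, -, hδ⟩ := exists_mem_Icc_isFixedPt_of_mapsTo
    -- The endpoints are the averages of the extreme age profiles `0` and `a₀ + t`; by monotonicity
    -- the map sends all of `ℝ` between them.
    (a := discountedAverage T ρ A₀ fun _ => 0)
    (b := discountedAverage T ρ A₀ fun t => a₀ + t) hcont.continuousOn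
    (discountedAverage_mono T A₀ hρ fun t => by positivity)
    (fun δ _ => ⟨discountedAverage_mono T A₀ hρ fun t => (hage δ t).1,
      discountedAverage_mono T A₀ hρ fun t => (hage δ t).2⟩)
  exact ⟨δ, hδ.symm⟩

/-- The estimator recovers `δ` from the closed-form ages that a self-consistent `δ` generates. -/
theorem SelfConsistent.estimator_eq {T : ℕ} {ρ α b A₀ a₀ δ : ℝ}
    (h : SelfConsistent T ρ α b A₀ a₀ δ) :
    estimator T ρ A₀ a₀ (fun i => closedFormAge T ρ α b a₀ δ ((i : ℕ) + 1)) = δ := by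
  refine Eq.trans (discountedAverage_congr T ρ A₀ fun t ht => ?_) h.symm
  rcases t with _ | t
  · simp [ageSequence, closedFormAge_zero]
  -- Only times below `T` enter the average, so the default `0` in `ageSequence` is never read.
  · have : t < T - 1 := by omega
    simp [ageSequence, this]

end AoI

theorem proposition2 (T : ℕ) (hT : 1 ≤ T)
    (ρ α b A₀ a₀ : ℝ)
    (hρ : ρ ∈ Set.Ioo (0 : ℝ) 1) (hα : α ∈ Set.Icc (0 : ℝ) 1) (hb : 0 < b) (ha₀ : 0 ≤ a₀) :
    ContinuousOn (AoI.Phi T ρ α b A₀ a₀) (AoI.Omega T a₀) ∧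
    Set.MapsTo (AoI.Phi T ρ α b A₀ a₀) (AoI.Omega T a₀) (AoI.Omega T a₀) ∧
    ∃ x ∈ AoI.Omega T a₀,
      Function.IsFixedPt (AoI.Phi T ρ α b A₀ a₀) x ∧
      AoI.SelfConsistent T ρ α b A₀ a₀ (AoI.estimator T ρ A₀ a₀ x) := by
  have hρ' := Set.Ioo_subset_Icc_self hρ
  have hage := fun δ => AoI.closedFormAge_mem_Icc T δ hρ' hα.1 hb ha₀
  -- The age bounds hold for every `δ`, so `Phi` sends any vector into the box.
  refine ⟨?_, fun x _ i _ => hage _ _, ?_⟩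
  · refine (continuous_pi fun i => ?_).continuousOn
    exact (AoI.continuous_closedFormAge T a₀ hρ'.1 hα.1 hb _).comp
      (AoI.continuous_estimator T ρ A₀ a₀)
  · obtain ⟨δ, hδ⟩ := AoI.exists_selfConsistent T A₀ hρ' hα.1 hb ha₀
    refine ⟨fun i => AoI.closedFormAge T ρ α b a₀ δ ((i : ℕ) + 1), fun i _ => hage _ _, ?_, ?_⟩
    · unfold Function.IsFixedPt AoI.Phi
      rw [hδ.estimator_eq]
    · rwa [hδ.estimator_eq]
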